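/- Links in $3$-space are understood here as unoriented link diagrams in the plane up to planar isotopy and the three Reidemeister moves (equivalently, links up to ambient isotopy). For integers $p,q,r$, let $P(p,q,r)$ be the pretzel link whose standard diagram consists of three vertical tassels placed side by side, with $|p|$, $|q|$, $|r|$ crossings respectively (right-handed half twists if the entry is positive, left-handed ones if it is negative), where adjacent tassels are joined at the top and at the bottom by an arc, and the left strand of the first tassel is joined to the right strand of the third one at the top and at the bottom by an outer arc. The pretzel knots $P(-3,3,2i+1)$, where $i$ is an integer with $i>2$, are pairwise distinct: if $i,j>2$ are integers with $i\neq j$, then $P(-3,3,2i+1)$ and $P(-3,3,2j+1)$ are not ambient isotopic. -/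

import Mathlib

/-!
# Links, link types and pretzel links

Links in 3-space are given by link diagrams in the plane, considered up to planar isotopy and
Reidemeister moves.  A link diagram is put in general position with respect to the height function
of the plane: its local maxima, local minima and crossings lie at pairwise different heights.
It is then recorded from top to bottom as a list of horizontal slices.  Each slice contains exactly
one local maximum, local minimum or crossing, and vertical strands to the left and right of it.
-/

namespace LinkTheory

/-- The elementary pieces of an unoriented link diagram. -/
inductive Piece : Type
  /-- A local maximum, the shape `∩`: no endpoint above, two endpoints below. -/
  | cap : Piece
  /-- A local minimum, the shape `∪`: two endpoints above, no endpoint below. -/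
  | cup : Piece
  /-- A crossing of two neighbouring strands, two endpoints above and two below. In
  `crossing true` the over-strand runs from the top right to the bottom left (the shape `/` lies
  over the shape `\`). In `crossing false` it runs from the top left to the bottom right. -/
  | crossing (b : Bool) : Piece

/-- The number of endpoints at the upper side of a piece. -/
def Piece.top : Piece → ℕ
  | .cap => 0
  | .cup => 2
  | .crossing _ => 2

/-- The number of endpoints at the lower side of a piece. -/
def Piece.bot : Piece → ℕ
  | .cap => 2
  | .cup => 0
  | .crossing _ => 2

/-- A horizontal slice of a diagram: one piece, with `left` vertical strands to the left of it.
(The number of vertical strands to the right of it is determined by the slices above.) -/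
structure Slice : Type where
  left : ℕ
  piece : Piece

/-- `∩` with `k` strands to its left. -/
abbrev cap (k : ℕ) : Slice := ⟨k, .cap⟩

/-- `∪` joining the strands number `k` and `k + 1` (counted from the left, starting at `0`). -/
abbrev cup (k : ℕ) : Slice := ⟨k, .cup⟩

/-- A crossing of the strands number `k` and `k + 1`. -/
abbrev crossing (b : Bool) (k : ℕ) : Slice := ⟨k, .crossing b⟩

/-- `IsTangle m w n`: the slices in `w` fit together, from top to bottom, to a tangle diagram with
`m` endpoints at the top and `n` endpoints at the bottom. -/
def IsTangle : ℕ → List Slice → ℕ → Prop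
  | m, [], n => m = n
  | m, s :: w, n =>
      ∃ r : ℕ, m = s.left + s.piece.top + r ∧ IsTangle (s.left + s.piece.bot + r) w n

/-- A link diagram: a tangle diagram without endpoints. -/
def LinkDiagram : Type := {w : List Slice // IsTangle 0 w 0}

/-- The local moves on diagrams. The first group consists of the planar isotopies that change the
list of slices, the second group of the Reidemeister moves. Each of them may be applied in either
direction. -/
inductive Move : List Slice → List Slice → Prop
  /-- Two pieces that lie side by side (with `d` strands between them) exchange their heights. -/
  | exchange (k d : ℕ) (p q : Piece) :
      Move [⟨k, p⟩, ⟨k + p.bot + d, q⟩] [⟨k + p.top + d, q⟩, ⟨k, p⟩]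
  /-- A maximum cancels with the minimum to the right of it. -/
  | zigzag_right (k : ℕ) : Move [cap k, cup (k + 1)] []
  /-- A maximum cancels with the minimum to the left of it. -/
  | zigzag_left (k : ℕ) : Move [cap (k + 1), cup k] []
  /-- A maximum passes through a crossing with another strand: that strand, which runs into the
  inside of the arc `∩`, crosses its right leg or its left leg (over it in both cases, or under it
  in both cases). -/
  | slide_cap (k : ℕ) (b : Bool) :
      Move [cap k, crossing b (k + 1)] [cap (k + 1), crossing (!b) k]
  /-- A minimum passes through a crossing with another strand. -/
  | slide_cup (k : ℕ) (b : Bool) :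
      Move [crossing b (k + 1), cup k] [crossing (!b) k, cup (k + 1)]
  /-- First Reidemeister move, at a maximum. -/
  | reidemeister_one_cap (k : ℕ) (b : Bool) : Move [cap k, crossing b k] [cap k]
  /-- First Reidemeister move, at a minimum. -/
  | reidemeister_one_cup (k : ℕ) (b : Bool) : Move [crossing b k, cup k] [cup k]
  /-- Second Reidemeister move. -/
  | reidemeister_two (k : ℕ) (b : Bool) : Move [crossing b k, crossing (!b) k] []
  /-- Third Reidemeister move. Here `a`, `b`, `c` are the crossings of the strands 1 and 2, 1 and 3,
  2 and 3. The condition says that one of the strands lies above the two others, one below. -/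
  | reidemeister_three (k : ℕ) (a b c : Bool) (h : b = a ∨ b = c) :
      Move [crossing a k, crossing b (k + 1), crossing c k]
        [crossing c (k + 1), crossing b k, crossing a (k + 1)]

/-- The link diagram `E` arises from the link diagram `D` by one local move. -/
def Step (D E : LinkDiagram) : Prop :=
  ∃ u l r v : List Slice, Move l r ∧ D.1 = u ++ l ++ v ∧ E.1 = u ++ r ++ v

/-- The setoid on link diagrams generated by planar isotopy and the Reidemeister moves. -/
instance isotopy : Setoid LinkDiagram := Relation.EqvGen.setoid Step

/-- Link types: unoriented links up to ambient isotopy, that is, link diagrams up to planar isotopy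
and Reidemeister moves. -/
def LinkType : Type := Quotient isotopy

/-- A tassel with `p` half twists: `|p|` crossings, one below the other, of the strands number `k`
and `k + 1`. They are right-handed for `p > 0`, left-handed for `p < 0`. -/
def tassel (k : ℕ) (p : ℤ) : List Slice :=
  List.replicate p.natAbs (crossing (decide (0 < p)) k)

/-- The slices of the standard diagram of the pretzel link `P(p, q, r)`. Three tassels stand side by
side, on the strands 0 and 1, 2 and 3, 4 and 5. At the top and at the bottom, arcs join
the strands 1 and 2, the strands 3 and 4, and (on the outside) the strands 0 and 5. -/
def pretzelSlices (p q r : ℤ) : List Slice :=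
  [cap 0, cap 1, cap 3] ++ (tassel 0 p ++ (tassel 2 q ++ (tassel 4 r ++ [cup 3, cup 1, cup 0])))

theorem isTangle_replicate_append (c : Bool) (k r n : ℕ) (w : List Slice) (N : ℕ)
    (hw : IsTangle (k + 2 + r) w n) :
    IsTangle (k + 2 + r) (List.replicate N (crossing c k) ++ w) n := by
  induction N with
  | zero => simpa using hw
  | succ N ih => exact ⟨r, rfl, ih⟩

theorem isTangle_pretzelSlices (p q r : ℤ) : IsTangle 0 (pretzelSlices p q r) 0 := by
  refine ⟨0, rfl, 1, rfl, 1, rfl, ?_⟩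
  refine isTangle_replicate_append _ 0 4 0 _ _ ?_
  refine isTangle_replicate_append _ 2 2 0 _ _ ?_
  refine isTangle_replicate_append _ 4 0 0 _ _ ?_
  exact ⟨1, rfl, 1, rfl, 0, rfl, rfl⟩

/-- The standard diagram of the pretzel link `P(p, q, r)`. -/
def pretzelDiagram (p q r : ℤ) : LinkDiagram :=
  ⟨pretzelSlices p q r, isTangle_pretzelSlices p q r⟩

/-- The pretzel link `P(p, q, r)`, as a link type. -/
def pretzel (p q r : ℤ) : LinkType := Quotient.mk isotopy (pretzelDiagram p q r)

end LinkTheory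

/-! The Kauffman bracket at the single value `A = 2` separates these knots. Crossings, maxima and
minima act as operators, and a diagram acts by their product. By `exists_bracketOp_eq_of_isotopy`
this product is invariant up to powers of `-A ^ 3`, so neither writhe nor orientation is needed.

For odd `N`, the diagram of `P(-3,3,N)` acts by the scalar `-17/4 * 8⁻ᴺ * (-15786225 * 16ᴺ⁻³ - 1)`
(`bracketOp_pretzelSlices`). If `N > 3`, the last factor is an odd integer. For two isotopic knots
of the family these odd integers differ by a power of `-8`, hence agree
(`eq_of_odd_of_eq_zpow_mul`), and this determines `N`. -/

namespace LinkTheory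

/-! ### The Kauffman bracket as a vertex model

States assign `Bool` labels to infinitely many strands; strands of a diagram that are not used
continue vertically, so that no bookkeeping of the number of strands is necessary. -/

section Bracket

variable {K : Type*} [Field K]

/-- Removes the strands number `k` and `k + 1`. -/
def deleteTwo (k : ℕ) (s : ℕ → Bool) : ℕ → Bool :=
  fun n => if n < k then s n else s (n + 2)

/-- Inserts strands number `k` and `k + 1` with labels `a` and `!a`. -/
def insertTwo (k : ℕ) (a : Bool) (s : ℕ → Bool) : ℕ → Bool :=
  fun n => if n < k then s n else if n = k then a else if n = k + 1 then !a else s (n - 2)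

/-- The Boltzmann weight of a minimum. -/
def cupWeight (A : K) : Bool → Bool → K
  | false, true => 1
  | true, false => -(A ^ 2)⁻¹
  | _, _ => 0

/-- The operator of a minimum. -/
def cupOp (A : K) (k : ℕ) : Module.End K ((ℕ → Bool) → K) where
  toFun f s := cupWeight A (s k) (s (k + 1)) * f (deleteTwo k s)
  map_add' f g := by ext s; simp [mul_add]
  map_smul' c f := by ext s; simp [mul_left_comm]

/-- The operator of a maximum. -/
def capOp (A : K) (k : ℕ) : Module.End K ((ℕ → Bool) → K) where
  toFun f s := -A ^ 2 * f (insertTwo k false s) + f (insertTwo k true s)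
  map_add' f g := by ext s; simp; ring
  map_smul' c f := by ext s; simp; ring

/-- The coefficient of the vertical smoothing of a crossing. -/
def smoothingCoeff (A : K) (b : Bool) : K := if b then A else A⁻¹

/-- The operator of a crossing, given by the skein relation of the Kauffman bracket. -/
def crossingOp (A : K) (b : Bool) (k : ℕ) : Module.End K ((ℕ → Bool) → K) :=
  smoothingCoeff A b • 1 + smoothingCoeff A (!b) • (cupOp A k * capOp A k)

/-- The operator of a piece with `k` strands to its left. -/
def pieceOp (A : K) (k : ℕ) : Piece → Module.End K ((ℕ → Bool) → K)
  | .cap => capOp A k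
  | .cup => cupOp A k
  | .crossing b => crossingOp A b k

/-- The operator of a list of slices. -/
def bracketOp (A : K) (w : List Slice) : Module.End K ((ℕ → Bool) → K) :=
  (w.map fun s => pieceOp A s.left s.piece).prod

theorem bracketOp_append (A : K) (v w : List Slice) :
    bracketOp A (v ++ w) = bracketOp A v * bracketOp A w := by
  simp [bracketOp]

theorem deleteTwo_insertTwo (k : ℕ) (a : Bool) (s : ℕ → Bool) :
    deleteTwo k (insertTwo k a s) = s := by
  funext n; grind [deleteTwo, insertTwo]

theorem deleteTwo_succ_insertTwo (k : ℕ) (s : ℕ → Bool) :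
    deleteTwo (k + 1) (insertTwo k (s k) s) = s := by
  funext n; grind [deleteTwo, insertTwo]

theorem deleteTwo_insertTwo_succ (k : ℕ) (s : ℕ → Bool) :
    deleteTwo k (insertTwo (k + 1) (!s k) s) = s := by
  funext n; grind [deleteTwo, insertTwo]

theorem insertTwo_insertTwo {k n : ℕ} (h : k ≤ n) (a b : Bool) (s : ℕ → Bool) :
    insertTwo (n + 2) b (insertTwo k a s) = insertTwo k a (insertTwo n b s) := by
  funext m; grind [insertTwo]

theorem deleteTwo_insertTwo_add_two {k n : ℕ} (h : k ≤ n) (a : Bool) (s : ℕ → Bool) :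
    deleteTwo (n + 2) (insertTwo k a s) = insertTwo k a (deleteTwo n s) := by
  funext m; grind [insertTwo, deleteTwo]

theorem deleteTwo_insertTwo_of_le {k n : ℕ} (h : k ≤ n) (a : Bool) (s : ℕ → Bool) :
    deleteTwo k (insertTwo (n + 2) a s) = insertTwo n a (deleteTwo k s) := by
  funext m; grind [insertTwo, deleteTwo]

theorem deleteTwo_deleteTwo {k n : ℕ} (h : k ≤ n) (s : ℕ → Bool) :
    deleteTwo k (deleteTwo (n + 2) s) = deleteTwo n (deleteTwo k s) := by
  funext m; grind [deleteTwo]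

theorem capOp_mul_capOp (A : K) {k n : ℕ} (h : k ≤ n) :
    capOp A k * capOp A (n + 2) = capOp A n * capOp A k := by
  ext f s
  simp only [Module.End.mul_apply, capOp, LinearMap.coe_mk, AddHom.coe_mk, insertTwo_insertTwo h]
  ring

theorem capOp_mul_cupOp_of_le (A : K) {k n : ℕ} (h : k ≤ n) :
    capOp A k * cupOp A (n + 2) = cupOp A n * capOp A k := by
  ext f s
  have h1 (a : Bool) : insertTwo k a s (n + 2) = s n := by grind [insertTwo]
  have h2 (a : Bool) : insertTwo k a s (n + 2 + 1) = s (n + 1) := by grind [insertTwo]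
  simp only [Module.End.mul_apply, capOp, cupOp, LinearMap.coe_mk, AddHom.coe_mk,
    deleteTwo_insertTwo_add_two h, h1, h2]
  ring

theorem cupOp_mul_capOp_of_le (A : K) {k n : ℕ} (h : k ≤ n) :
    cupOp A k * capOp A n = capOp A (n + 2) * cupOp A k := by
  ext f s
  have h1 (a : Bool) : insertTwo (n + 2) a s k = s k := by grind [insertTwo]
  have h2 (a : Bool) : insertTwo (n + 2) a s (k + 1) = s (k + 1) := by grind [insertTwo]
  simp only [Module.End.mul_apply, capOp, cupOp, LinearMap.coe_mk, AddHom.coe_mk,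
    deleteTwo_insertTwo_of_le h, h1, h2]
  ring

theorem cupOp_mul_cupOp (A : K) {k n : ℕ} (h : k ≤ n) :
    cupOp A k * cupOp A n = cupOp A (n + 2) * cupOp A k := by
  ext f s
  have h1 : deleteTwo (n + 2) s k = s k := by grind [deleteTwo]
  have h2 : deleteTwo (n + 2) s (k + 1) = s (k + 1) := by grind [deleteTwo]
  have h3 : deleteTwo k s n = s (n + 2) := by grind [deleteTwo]
  have h4 : deleteTwo k s (n + 1) = s (n + 2 + 1) := by grind [deleteTwo]
  simp only [Module.End.mul_apply, cupOp, LinearMap.coe_mk, AddHom.coe_mk,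
    deleteTwo_deleteTwo h, h1, h2, h3, h4]
  ring

/-- The bracket of a circle. -/
def loopValue (A : K) : K := -A ^ 2 - (A ^ 2)⁻¹

theorem capOp_mul_cupOp_self (A : K) (k : ℕ) :
    capOp A k * cupOp A k = loopValue A • 1 := by
  ext f s
  have h1 (a : Bool) : insertTwo k a s k = a := by grind [insertTwo]
  have h2 (a : Bool) : insertTwo k a s (k + 1) = !a := by grind [insertTwo]
  simp [capOp, cupOp, h1, h2, deleteTwo_insertTwo, cupWeight, loopValue]
  ring

theorem capOp_mul_cupOp_succ {A : K} (hA : A ≠ 0) (k : ℕ) :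
    capOp A k * cupOp A (k + 1) = 1 := by
  ext f s
  have h1 (a : Bool) : insertTwo k a s (k + 1) = !a := by grind [insertTwo]
  have h2 (a : Bool) : insertTwo k a s (k + 1 + 1) = s k := by grind [insertTwo]
  have h3 := deleteTwo_succ_insertTwo k s
  cases hs : s k <;> rw [hs] at h3 <;>
    simp [capOp, cupOp, h1, h2, h3, hs, cupWeight, hA]

theorem capOp_succ_mul_cupOp {A : K} (hA : A ≠ 0) (k : ℕ) :
    capOp A (k + 1) * cupOp A k = 1 := by
  ext f s
  have h1 (a : Bool) : insertTwo (k + 1) a s k = s k := by grind [insertTwo]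
  have h2 (a : Bool) : insertTwo (k + 1) a s (k + 1) = a := by grind [insertTwo]
  have h3 := deleteTwo_insertTwo_succ k s
  cases hs : s k <;> rw [hs] at h3 <;> simp only [Bool.not_true, Bool.not_false] at h3 <;>
    simp [capOp, cupOp, h1, h2, h3, hs, cupWeight, hA]

theorem capOp_mul_pieceOp (A : K) {k n : ℕ} (h : k ≤ n) (p : Piece) :
    capOp A k * pieceOp A (n + 2) p = pieceOp A n p * capOp A k := by
  cases p with
  | cap => exact capOp_mul_capOp A h
  | cup => exact capOp_mul_cupOp_of_le A h
  | crossing b =>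
    simp only [pieceOp, crossingOp, mul_add, add_mul, mul_smul_comm, smul_mul_assoc, mul_one,
      one_mul]
    rw [← mul_assoc, capOp_mul_cupOp_of_le A h, mul_assoc, capOp_mul_capOp A h, mul_assoc]

theorem cupOp_mul_pieceOp (A : K) {k n : ℕ} (h : k ≤ n) (p : Piece) :
    cupOp A k * pieceOp A n p = pieceOp A (n + 2) p * cupOp A k := by
  cases p with
  | cap => exact cupOp_mul_capOp_of_le A h
  | cup => exact cupOp_mul_cupOp A h
  | crossing b =>
    simp only [pieceOp, crossingOp, mul_add, add_mul, mul_smul_comm, smul_mul_assoc, mul_one,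
      one_mul]
    rw [← mul_assoc, cupOp_mul_cupOp A h, mul_assoc, cupOp_mul_capOp_of_le A h, mul_assoc]

/-- A crossing is a combination of `1` and a minimum times a maximum. Passing the maximum lowers the
index of `q` by two, and passing the minimum restores it. -/
theorem pieceOp_exchange (A : K) (k d : ℕ) (p q : Piece) :
    pieceOp A k p * pieceOp A (k + p.bot + d) q = pieceOp A (k + p.top + d) q * pieceOp A k p := by
  have h : k ≤ k + d := Nat.le_add_right k d
  have e : k + 2 + d = k + d + 2 := by omega
  cases p with
  | cap =>
    simp only [Piece.bot, Piece.top, e]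
    exact capOp_mul_pieceOp A h q
  | cup =>
    simp only [Piece.bot, Piece.top, e]
    exact cupOp_mul_pieceOp A h q
  | crossing b =>
    have hb : pieceOp A k (.crossing b) = crossingOp A b k := rfl
    simp only [Piece.bot, Piece.top, e, hb, crossingOp, mul_add, add_mul, mul_smul_comm,
      smul_mul_assoc, mul_one, one_mul]
    rw [mul_assoc, capOp_mul_pieceOp A h, ← mul_assoc, cupOp_mul_pieceOp A h, mul_assoc]

/-! ### Slides and Reidemeister moves -/

theorem smoothingCoeff_mul_not {A : K} (hA : A ≠ 0) (b : Bool) :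
    smoothingCoeff A b * smoothingCoeff A (!b) = 1 := by
  cases b <;> simp [smoothingCoeff, hA]

/-- Smoothing the crossing and straightening the zigzag turns both sides into the same combination
of `capOp A k` and `capOp A (k + 1)`. -/
theorem capOp_mul_crossingOp_succ {A : K} (hA : A ≠ 0) (k : ℕ) (b : Bool) :
    capOp A k * crossingOp A b (k + 1) = capOp A (k + 1) * crossingOp A (!b) k := by
  simp only [crossingOp, mul_add, mul_smul_comm, mul_one, ← mul_assoc, capOp_mul_cupOp_succ hA,
    capOp_succ_mul_cupOp hA, one_mul, Bool.not_not]
  abel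

theorem crossingOp_succ_mul_cupOp {A : K} (hA : A ≠ 0) (k : ℕ) (b : Bool) :
    crossingOp A b (k + 1) * cupOp A k = crossingOp A (!b) k * cupOp A (k + 1) := by
  simp only [crossingOp, add_mul, smul_mul_assoc, one_mul, mul_assoc, capOp_mul_cupOp_succ hA,
    capOp_succ_mul_cupOp hA, mul_one, Bool.not_not]
  abel

/-- The factor by which a curl changes the bracket. -/
def curlFactor (A : K) (b : Bool) : K := -(smoothingCoeff A (!b)) ^ 3

theorem smoothingCoeff_add_loopValue {A : K} (hA : A ≠ 0) (b : Bool) :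
    smoothingCoeff A b + smoothingCoeff A (!b) * loopValue A = curlFactor A b := by
  cases b <;> simp [smoothingCoeff, curlFactor, loopValue] <;> field_simp <;> ring

theorem capOp_mul_crossingOp {A : K} (hA : A ≠ 0) (k : ℕ) (b : Bool) :
    capOp A k * crossingOp A b k = curlFactor A b • capOp A k := by
  simp only [crossingOp, mul_add, mul_smul_comm, mul_one, ← mul_assoc, capOp_mul_cupOp_self,
    smul_mul_assoc, one_mul, smul_smul, ← add_smul, smoothingCoeff_add_loopValue hA]

theorem crossingOp_mul_cupOp {A : K} (hA : A ≠ 0) (k : ℕ) (b : Bool) :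
    crossingOp A b k * cupOp A k = curlFactor A b • cupOp A k := by
  simp only [crossingOp, add_mul, smul_mul_assoc, mul_one, mul_assoc, capOp_mul_cupOp_self,
    mul_smul_comm, one_mul, smul_smul, ← add_smul, smoothingCoeff_add_loopValue hA]

theorem crossingOp_mul_crossingOp_not {A : K} (hA : A ≠ 0) (k : ℕ) (b : Bool) :
    crossingOp A b k * crossingOp A (!b) k = 1 := by
  conv_lhs => rw [crossingOp]
  -- Only the first crossing is smoothed at this point: its maximum meets the second crossing in a
  -- curl.
  rw [add_mul, smul_mul_assoc, smul_mul_assoc, mul_assoc, capOp_mul_crossingOp hA, crossingOp]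
  simp only [one_mul, mul_smul_comm, smul_add, smul_smul, Bool.not_not,
    smoothingCoeff_mul_not hA, one_smul, add_assoc, ← add_smul]
  convert add_zero _
  convert zero_smul K _
  cases b <;> simp [smoothingCoeff, curlFactor] <;> field_simp <;> ring

/-- A crossing passes below or above a third strand: the Reidemeister move when the two crossings
with that strand have the same type. -/
theorem crossingOp_braid_left {A : K} (hA : A ≠ 0) (k : ℕ) (a c : Bool) :
    crossingOp A a k * crossingOp A a (k + 1) * crossingOp A c k =
      crossingOp A c (k + 1) * crossingOp A a k * crossingOp A a (k + 1) := by
  have h1 : crossingOp A a k * crossingOp A a (k + 1) * cupOp A k = cupOp A (k + 1) := by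
    rw [mul_assoc, crossingOp_succ_mul_cupOp hA, ← mul_assoc, crossingOp_mul_crossingOp_not hA,
      one_mul]
  have h2 : capOp A (k + 1) * crossingOp A a k * crossingOp A a (k + 1) = capOp A k := by
    have := capOp_mul_crossingOp_succ hA k (!a)
    rw [Bool.not_not] at this
    rw [← this, mul_assoc]
    have := crossingOp_mul_crossingOp_not hA (k + 1) (!a)
    rw [Bool.not_not] at this
    rw [this, mul_one]
  -- Only the crossing of type `c` is smoothed. By `h1` and `h2` the resulting minimum or maximum
  -- slides through the two other crossings.
  have e (j : ℕ) : crossingOp A c j = smoothingCoeff A c • 1 +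
      smoothingCoeff A (!c) • (cupOp A j * capOp A j) := rfl
  simp only [e, mul_add, add_mul, mul_smul_comm, smul_mul_assoc, mul_one, one_mul]
  rw [← mul_assoc _ (cupOp A k), h1, mul_assoc (cupOp A (k + 1)), mul_assoc (cupOp A (k + 1)),
    ← mul_assoc, ← mul_assoc, mul_assoc (cupOp A (k + 1)), mul_assoc (cupOp A (k + 1)), h2]

theorem crossingOp_braid_right {A : K} (hA : A ≠ 0) (k : ℕ) (a c : Bool) :
    crossingOp A a k * crossingOp A c (k + 1) * crossingOp A c k =
      crossingOp A c (k + 1) * crossingOp A c k * crossingOp A a (k + 1) := by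
  have h1 : crossingOp A c (k + 1) * crossingOp A c k * cupOp A (k + 1) = cupOp A k := by
    have := crossingOp_succ_mul_cupOp hA k (!c)
    rw [Bool.not_not] at this
    rw [mul_assoc, ← this, ← mul_assoc, crossingOp_mul_crossingOp_not hA, one_mul]
  have h2 : capOp A k * crossingOp A c (k + 1) * crossingOp A c k = capOp A (k + 1) := by
    have := crossingOp_mul_crossingOp_not hA k (!c)
    rw [Bool.not_not] at this
    rw [capOp_mul_crossingOp_succ hA, mul_assoc, this, mul_one]
  have e (j : ℕ) : crossingOp A a j = smoothingCoeff A a • 1 +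
      smoothingCoeff A (!a) • (cupOp A j * capOp A j) := rfl
  simp only [e, mul_add, add_mul, mul_smul_comm, smul_mul_assoc, mul_one, one_mul]
  rw [← mul_assoc _ (cupOp A (k + 1)), h1, mul_assoc (cupOp A k), mul_assoc (cupOp A k),
    h2]

/-! ### Invariance up to powers of `-A ^ 3`; only the first Reidemeister move contributes a factor
-/

theorem exists_bracketOp_eq_of_move {A : K} (hA : A ≠ 0) {l r : List Slice} (h : Move l r) :
    ∃ n : ℤ, bracketOp A l = (-A ^ 3) ^ n • bracketOp A r := by
  have curl (b : Bool) : ∃ n : ℤ, curlFactor A b = (-A ^ 3) ^ n := by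
    cases b
    · exact ⟨1, by simp [curlFactor, smoothingCoeff]⟩
    · exact ⟨-1, by simp [curlFactor, smoothingCoeff, inv_neg]⟩
  cases h with
  | exchange k d p q => exact ⟨0, by simpa [bracketOp] using pieceOp_exchange A k d p q⟩
  | zigzag_right k => exact ⟨0, by simpa [bracketOp, pieceOp] using capOp_mul_cupOp_succ hA k⟩
  | zigzag_left k => exact ⟨0, by simpa [bracketOp, pieceOp] using capOp_succ_mul_cupOp hA k⟩
  | slide_cap k b =>
    exact ⟨0, by simpa [bracketOp, pieceOp] using capOp_mul_crossingOp_succ hA k b⟩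
  | slide_cup k b =>
    exact ⟨0, by simpa [bracketOp, pieceOp] using crossingOp_succ_mul_cupOp hA k b⟩
  | reidemeister_one_cap k b =>
    obtain ⟨n, hn⟩ := curl b
    exact ⟨n, by simpa [bracketOp, pieceOp, hn] using capOp_mul_crossingOp hA k b⟩
  | reidemeister_one_cup k b =>
    obtain ⟨n, hn⟩ := curl b
    exact ⟨n, by simpa [bracketOp, pieceOp, hn] using crossingOp_mul_cupOp hA k b⟩
  | reidemeister_two k b =>
    exact ⟨0, by simpa [bracketOp, pieceOp] using crossingOp_mul_crossingOp_not hA k b⟩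
  | reidemeister_three k a b c h =>
    refine ⟨0, ?_⟩
    rcases h with rfl | rfl
    · simpa [bracketOp, pieceOp, mul_assoc] using crossingOp_braid_left hA k b c
    · simpa [bracketOp, pieceOp, mul_assoc] using crossingOp_braid_right hA k a b

theorem exists_bracketOp_eq_of_isotopy {A : K} (hA : A ≠ 0) {D E : LinkDiagram}
    (h : Relation.EqvGen Step D E) :
    ∃ n : ℤ, bracketOp A D.1 = (-A ^ 3) ^ n • bracketOp A E.1 := by
  have hA3 : -A ^ 3 ≠ 0 := neg_ne_zero.2 (pow_ne_zero 3 hA)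
  induction h with
  | rel D E h =>
    obtain ⟨u, l, r, v, hm, hD, hE⟩ := h
    obtain ⟨n, hn⟩ := exists_bracketOp_eq_of_move hA hm
    exact ⟨n, by simp [hD, hE, bracketOp_append, hn]⟩
  | refl D => exact ⟨0, by simp⟩
  | symm D E _ ih =>
    obtain ⟨n, hn⟩ := ih
    exact ⟨-n, by rw [hn, smul_smul, ← zpow_add₀ hA3]; simp⟩
  | trans D E F _ _ ih₁ ih₂ =>
    obtain ⟨m, hm⟩ := ih₁
    obtain ⟨n, hn⟩ := ih₂
    exact ⟨m + n, by rw [hm, hn, smul_smul, zpow_add₀ hA3]⟩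

/-! ### The bracket of pretzel links -/

/-- Closing the twists with a maximum turns each crossing into a curl. The resulting second equation
determines `c` whenever `loopValue A ≠ 0`. -/
theorem exists_bracketOp_replicate_crossing {A : K} (hA : A ≠ 0) (b : Bool) (k n : ℕ) :
    ∃ c : K, bracketOp A (List.replicate n (crossing b k)) =
        smoothingCoeff A b ^ n • 1 + c • (cupOp A k * capOp A k) ∧
      smoothingCoeff A b ^ n + c * loopValue A = curlFactor A b ^ n := by
  induction n with
  | zero => exact ⟨0, by simp [bracketOp]⟩
  | succ n ih =>
    obtain ⟨c, h, hc⟩ := ih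
    refine ⟨smoothingCoeff A b ^ n * smoothingCoeff A (!b) + c * curlFactor A b, ?_, ?_⟩
    · rw [List.replicate_succ', bracketOp_append, h, add_mul, smul_mul_assoc, smul_mul_assoc,
        mul_assoc]
      have : bracketOp A [crossing b k] = crossingOp A b k := by simp [bracketOp, pieceOp]
      rw [this, capOp_mul_crossingOp hA, crossingOp]
      simp only [mul_smul_comm, one_mul]
      module
    · have := smoothingCoeff_add_loopValue hA b
      rw [pow_succ (curlFactor A b), ← hc, ← this]
      ring

theorem capOp_mul_cupOp {A : K} (hA : A ≠ 0) (i j : ℕ) :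
    capOp A i * cupOp A j = if i = j then loopValue A • 1 else if i + 1 = j ∨ j + 1 = i then 1
      else if i < j then cupOp A (j - 2) * capOp A i else cupOp A j * capOp A (i - 2) := by
  split_ifs with h₁ h₂ h₃
  · rw [h₁, capOp_mul_cupOp_self]
  · rcases h₂ with rfl | rfl
    · exact capOp_mul_cupOp_succ hA i
    · exact capOp_succ_mul_cupOp hA j
  · obtain ⟨n, rfl⟩ : ∃ n, j = n + 2 := ⟨j - 2, by omega⟩
    exact capOp_mul_cupOp_of_le A (by omega)
  · obtain ⟨n, rfl⟩ : ∃ n, i = n + 2 := ⟨i - 2, by omega⟩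
    exact (cupOp_mul_capOp_of_le A (by omega)).symm

/-- State sum over the eight ways to smooth whole tassels (`aᵢ` vertical, `cᵢ` horizontal); the
exponent of `loopValue A` counts the circles. -/
theorem pretzel_operator_eq {A : K} (hA : A ≠ 0) (a₁ a₂ a₃ c₁ c₂ c₃ : K) :
    capOp A 0 * (capOp A 1 * (capOp A 3 * ((a₁ • 1 + c₁ • (cupOp A 0 * capOp A 0)) *
      ((a₂ • 1 + c₂ • (cupOp A 2 * capOp A 2)) * ((a₃ • 1 + c₃ • (cupOp A 4 * capOp A 4)) *
        (cupOp A 3 * (cupOp A 1 * cupOp A 0))))))) =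
    (a₁ * a₂ * a₃ * loopValue A ^ 3
      + (c₁ * a₂ * a₃ + a₁ * c₂ * a₃ + a₁ * a₂ * c₃ + c₁ * c₂ * c₃) * loopValue A ^ 2
      + (c₁ * c₂ * a₃ + c₁ * a₂ * c₃ + a₁ * c₂ * c₃) * loopValue A) •
      (1 : Module.End K ((ℕ → Bool) → K)) := by
  -- As rewriting rules these push maxima to the right past minima until each cancels against a
  -- minimum.
  have h (i j : ℕ) (X : Module.End K ((ℕ → Bool) → K)) : capOp A i * (cupOp A j * X) =
      if i = j then loopValue A • X else if i + 1 = j ∨ j + 1 = i then X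
      else if i < j then cupOp A (j - 2) * (capOp A i * X)
      else cupOp A j * (capOp A (i - 2) * X) := by
    rw [← mul_assoc, capOp_mul_cupOp hA]
    split_ifs <;> simp [mul_assoc]
  simp [mul_add, add_mul, mul_assoc, h, capOp_mul_cupOp hA]
  module

end Bracket

/-! ### Evaluation at `A = 2` and comparison of odd parts -/

theorem bracketOp_pretzelSlices {N : ℕ} (hN : Odd N) :
    bracketOp (2 : ℚ) (pretzelSlices (-3) 3 N) =
      (-17 / 4 * (8 ^ N)⁻¹ * (-15786225 * 16 ^ N / 4096 - 1) : ℚ) • 1 := by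
  obtain ⟨c₁, h₁, e₁⟩ := exists_bracketOp_replicate_crossing (two_ne_zero (α := ℚ)) false 0 3
  obtain ⟨c₂, h₂, e₂⟩ := exists_bracketOp_replicate_crossing (two_ne_zero (α := ℚ)) true 2 3
  obtain ⟨c₃, h₃, e₃⟩ := exists_bracketOp_replicate_crossing (two_ne_zero (α := ℚ)) true 4 N
  have t₁ : tassel 0 (-3) = List.replicate 3 (crossing false 0) := rfl
  have t₂ : tassel 2 3 = List.replicate 3 (crossing true 2) := rfl
  have t₃ : tassel 4 N = List.replicate N (crossing true 4) := by
    simp [tassel, hN.pos]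
  have hcap : bracketOp (2 : ℚ) [cap 0, cap 1, cap 3] = capOp 2 0 * capOp 2 1 * capOp 2 3 := by
    simp [bracketOp, pieceOp, mul_assoc]
  have hcup : bracketOp (2 : ℚ) [cup 3, cup 1, cup 0] =
      cupOp 2 3 * (cupOp 2 1 * cupOp 2 0) := by
    simp [bracketOp, pieceOp]
  rw [pretzelSlices, t₁, t₂, t₃]
  simp only [bracketOp_append]
  rw [h₁, h₂, h₃, hcap, hcup, mul_assoc, mul_assoc, pretzel_operator_eq two_ne_zero]
  congr 1
  norm_num [smoothingCoeff, curlFactor, loopValue, hN.neg_pow] at e₁ e₂ e₃ ⊢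
  -- Here `loopValue 2 = -17/4`, so `e₁`, `e₂`, `e₃` can be solved for the coefficients.
  obtain rfl : c₁ = 241 / 2 := by linarith
  obtain rfl : c₂ = 241 / 128 := by linarith
  have hpow : (2 : ℚ) ^ N = (8 ^ N)⁻¹ * 16 ^ N := by
    rw [← inv_pow, ← mul_pow]; norm_num
  obtain rfl : c₃ = 4 / 17 * ((8 ^ N)⁻¹ * 16 ^ N + (8 ^ N)⁻¹) := by
    rw [one_div, inv_pow, hpow] at e₃
    linarith
  rw [hpow]
  ring

/-- A nonzero power of `-8` would make `x` or `y` even. -/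
theorem eq_of_odd_of_eq_zpow_mul {x y : ℤ} (hx : Odd x) (hy : Odd y) {n : ℤ}
    (h : (x : ℚ) = (-8) ^ n * y) : x = y := by
  have aux {u v : ℤ} (hu : Odd u) {m : ℕ} (h : u = (-8) ^ m * v) : m = 0 := by
    by_contra hm
    rw [h, Int.odd_mul, Int.odd_pow] at hu
    exact absurd (hu.1.resolve_right hm) (by decide)
  obtain ⟨m, rfl | rfl⟩ := n.eq_nat_or_neg
  · rw [zpow_natCast] at h
    have h : x = (-8) ^ m * y := by exact_mod_cast h
    simpa [aux hx h] using h
  · rw [zpow_neg, zpow_natCast, eq_inv_mul_iff_mul_eq₀ (pow_ne_zero m (by norm_num : (-8 : ℚ) ≠ 0))] at h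
    have h : y = (-8) ^ m * x := by exact_mod_cast h.symm
    simpa [aux hy h] using h.symm

theorem eq_of_pretzel_eq {M N : ℕ} (hM : Odd M) (hN : Odd N) (hM' : 3 < M) (hN' : 3 < N)
    (h : pretzel (-3) 3 M = pretzel (-3) 3 N) : M = N := by
  have hiso : Relation.EqvGen Step (pretzelDiagram (-3) 3 M) (pretzelDiagram (-3) 3 N) :=
    Quotient.exact h
  obtain ⟨n, hn⟩ : ∃ n : ℤ, bracketOp (2 : ℚ) (pretzelSlices (-3) 3 M) =
      (-2 ^ 3 : ℚ) ^ n • bracketOp (2 : ℚ) (pretzelSlices (-3) 3 N) :=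
    exists_bracketOp_eq_of_isotopy two_ne_zero hiso
  rw [bracketOp_pretzelSlices hM, bracketOp_pretzelSlices hN, smul_smul] at hn
  -- Applying both scalar operators to a constant function reads off the scalars.
  have hn := congrFun (LinearMap.congr_fun hn fun _ => 1) fun _ => false
  simp only [LinearMap.smul_apply, Module.End.one_apply, Pi.smul_apply, smul_eq_mul, mul_one]
    at hn
  -- Now `16 ^ M / 4096 = 16 ^ (a + 1)` with a positive exponent, whence the oddness below.
  obtain ⟨a, rfl⟩ : ∃ a, M = a + 4 := ⟨M - 4, by omega⟩
  obtain ⟨b, rfl⟩ : ∃ b, N = b + 4 := ⟨N - 4, by omega⟩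
  have hodd (c : ℕ) : Odd (-15786225 * 16 ^ (c + 1) - 1 : ℤ) := by
    rw [pow_succ]
    exact ⟨-15786225 * 16 ^ c * 8 - 1, by ring⟩
  -- The exponent is even, so the factor `8 ^ (M - N)` is also a power of `-8` and merges with the
  -- factor from isotopy.
  have hpar : Even ((a + 4 : ℕ) - (b + 4 : ℕ) : ℤ) := by
    rw [Int.even_sub']
    simp only [Int.odd_coe_nat, hM, hN]
  have key := eq_of_odd_of_eq_zpow_mul (hodd a) (hodd b)
    (n := n + ((a + 4 : ℕ) - (b + 4 : ℕ))) <| by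
      rw [zpow_add₀ (by norm_num), hpar.neg_zpow, zpow_sub₀ (by norm_num), zpow_natCast,
        zpow_natCast]
      have h8 : (-2 ^ 3 : ℚ) = -8 := by norm_num
      rw [h8] at hn
      push_cast
      field_simp at hn ⊢
      ring_nf at hn ⊢
      linarith
  have key : (16 : ℤ) ^ (a + 1) = 16 ^ (b + 1) := by linarith
  have := Int.pow_right_injective (by norm_num) key
  omega

end LinkTheory

theorem corollary3p1 :
    ∀ i j : ℤ, 2 < i → 2 < j → i ≠ j →
      LinkTheory.pretzel (-3) 3 (2 * i + 1) ≠ LinkTheory.pretzel (-3) 3 (2 * j + 1) := by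
  intro i j hi hj hij h
  obtain ⟨a, rfl⟩ := Int.eq_ofNat_of_zero_le (show 0 ≤ i by omega)
  obtain ⟨b, rfl⟩ := Int.eq_ofNat_of_zero_le (show 0 ≤ j by omega)
  have := LinkTheory.eq_of_pretzel_eq (M := 2 * a + 1) (N := 2 * b + 1) ⟨a, rfl⟩ ⟨b, rfl⟩
    (by omega) (by omega) (by exact_mod_cast h)
  omega
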